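/- Let $\mathcal G$ be a non-empty ample groupoid, i.e. a topological groupoid (not necessarily Hausdorff) whose unit space $\mathcal G^{(0)}$ is locally compact, Hausdorff and totally disconnected and whose source and range maps $s,r\colon\mathcal G\to\mathcal G^{(0)}$ are local homeomorphisms. Let $\mathcal T\subseteq\mathcal G^{(0)}$ be the set of units with trivial isotropy group. Assume that $\mathcal G$ is topologically principal ($\mathcal T$ is dense in $\mathcal G^{(0)}$) and minimal (the only open subsets $D\subseteq\mathcal G^{(0)}$ such that $s(\gamma)\in D$ implies $r(\gamma)\in D$ for all $\gamma\in\mathcal G$ are $\varnothing$ and $\mathcal G^{(0)}$). Let $S$ be a semifield, i.e. a nontrivial commutative semiring in which every nonzero element has a multiplicative inverse. Let $A_S(\mathcal G)$ be the Steinberg algebra: the $S$-submodule of $S^{\mathcal G}$ generated by the characteristic functions of compact open bisections (subsets $U\subseteq\mathcal G$ on which $s$ and $r$ restrict to homeomorphisms onto their images), with the convolution product $(f*g)(\gamma)=\sum_{\alpha\beta=\gamma}f(\alpha)g(\beta)$. Let $\equiv$ be the congruence on $A_S(\mathcal G)$ given by $f\equiv g$ if and only if $f(\alpha)=g(\alpha)$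 for all $\alpha\in\mathcal G$ with $s(\alpha),r(\alpha)\in\mathcal T$. Then the quotient $A_S(\mathcal G)/{\equiv}$ is congruence-simple (its only congruences, i.e. equivalence relations compatible with addition and multiplication, are the diagonal one and the full one) if and only if $S$ is either a field or isomorphic to the Boolean semifield $\mathbb B=(\{0,1\},\mathrm{or},\mathrm{and})$. -/

import Mathlib

open CategoryTheory

universe u v w

/-! ### The Boolean semifield -/

/-- The Boolean semifield `({0, 1}, or, and)`. -/
def BoolSemifield : Type := Bool

namespace BoolSemifield

instance : Semifield BoolSemifield where
  add a b := Bool.or a b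
  zero := false
  mul a b := Bool.and a b
  one := true
  inv a := a
  nsmul n a := @nsmulRec Bool ⟨false⟩ ⟨Bool.or⟩ n a
  nnqsmul := _
  nnqsmul_def _ _ := rfl
  add_assoc := Bool.or_assoc
  zero_add := Bool.false_or
  add_zero := Bool.or_false
  add_comm := Bool.or_comm
  left_distrib := Bool.and_or_distrib_left
  right_distrib := Bool.and_or_distrib_right
  zero_mul := Bool.false_and
  mul_zero := Bool.and_false
  mul_assoc := Bool.and_assoc
  one_mul := Bool.true_and
  mul_one := Bool.and_true
  mul_comm := Bool.and_comm
  exists_pair_ne := ⟨false, true, Bool.false_ne_true⟩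
  inv_zero := rfl
  mul_inv_cancel a ha := by
    cases a with
    | false => exact absurd rfl ha
    | true => rfl

end BoolSemifield

/-! ### Ample groupoids -/

/-- The set of all arrows of a groupoid. -/
structure Arrows (C : Type u) [Groupoid.{v} C] where
  /-- the source object -/
  src : C
  /-- the range object -/
  tgt : C
  /-- the underlying morphism -/
  hom : src ⟶ tgt

namespace Arrows

variable {C : Type u} [Groupoid.{v} C]

/-- The unit at an object. -/
def unit (x : C) : Arrows C := ⟨x, x, 𝟙 x⟩

/-- The product `α β`, defined when the source of `α` is the range of `β`; it is the morphism
"first `β`, then `α`". -/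
def comp (α β : Arrows C) (h : α.src = β.tgt) : Arrows C :=
  ⟨β.src, α.tgt, β.hom ≫ eqToHom h.symm ≫ α.hom⟩

/-- The inverse arrow. -/
def inv (α : Arrows C) : Arrows C := ⟨α.tgt, α.src, Groupoid.inv α.hom⟩

variable (C) in
/-- The unit space, a subset (and, given a topology on the arrows, a subspace) of the arrows. -/
def unitSpace : Set (Arrows C) := Set.range unit

/-- The source map into the unit space. -/
def s (α : Arrows C) : unitSpace C := ⟨unit α.src, α.src, rfl⟩

/-- The range map into the unit space. -/
def r (α : Arrows C) : unitSpace C := ⟨unit α.tgt, α.tgt, rfl⟩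

theorem s_eq_s {α β : Arrows C} : s α = s β ↔ α.src = β.src :=
  ⟨fun h => congrArg (fun a : unitSpace C => a.1.src) h, fun h => by simp only [s, h]⟩

theorem r_eq_r {α β : Arrows C} : r α = r β ↔ α.tgt = β.tgt :=
  ⟨fun h => congrArg (fun a : unitSpace C => a.1.src) h, fun h => by simp only [r, h]⟩

theorem s_eq_r {α β : Arrows C} : s α = r β ↔ α.src = β.tgt :=
  ⟨fun h => congrArg (fun a : unitSpace C => a.1.src) h, fun h => by simp only [s, r, h]⟩

theorem comp_inv_comp (α β : Arrows C) (h : α.src = β.tgt) :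
    (α.comp β h).comp β.inv rfl = α := by
  obtain ⟨a, b, f⟩ := α
  obtain ⟨c, d, g⟩ := β
  obtain rfl : a = d := h
  simp [comp, inv]

theorem inv_comp_comp (α β : Arrows C) (h : α.src = β.tgt) :
    α.inv.comp (α.comp β h) rfl = β := by
  obtain ⟨a, b, f⟩ := α
  obtain ⟨c, d, g⟩ := β
  obtain rfl : a = d := h
  simp [comp, inv]

theorem comp_comp_inv (γ β : Arrows C) (h : γ.src = β.src) :
    (γ.comp β.inv h).comp β rfl = γ := by
  obtain ⟨a, b, f⟩ := γ
  obtain ⟨c, d, g⟩ := β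
  obtain rfl : a = c := h
  change (⟨a, b, g ≫ 𝟙 d ≫ Groupoid.inv g ≫ 𝟙 a ≫ f⟩ : Arrows C) = _
  simp

theorem comp_assoc (α β γ : Arrows C) (h : α.src = β.tgt) (h' : β.src = γ.tgt) :
    (α.comp β h).comp γ h' = α.comp (β.comp γ h') h := by
  simp [comp]

end Arrows

/-- A topological groupoid: composition, on the space of composable pairs, and inversion are
continuous. -/
class IsTopologicalGroupoid (C : Type u) [Groupoid.{v} C] [TopologicalSpace (Arrows C)] :
    Prop where
  continuous_comp : Continuous fun p : {p : Arrows C × Arrows C // p.1.src = p.2.tgt} =>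
    p.1.1.comp p.1.2 p.2
  continuous_inv : Continuous (Arrows.inv : Arrows C → Arrows C)

/-- An étale groupoid: the unit space is locally compact Hausdorff and source and range maps are
local homeomorphisms onto it. -/
class IsEtaleGroupoid (C : Type u) [Groupoid.{v} C] [TopologicalSpace (Arrows C)] : Prop
    extends IsTopologicalGroupoid C where
  locallyCompact : LocallyCompactSpace (Arrows.unitSpace C)
  hausdorff : T2Space (Arrows.unitSpace C)
  isLocalHomeomorph_s : IsLocalHomeomorph (Arrows.s : Arrows C → Arrows.unitSpace C)
  isLocalHomeomorph_r : IsLocalHomeomorph (Arrows.r : Arrows C → Arrows.unitSpace C)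

/-- An ample groupoid: an étale groupoid whose unit space is totally disconnected. -/
class IsAmpleGroupoid (C : Type u) [Groupoid.{v} C] [TopologicalSpace (Arrows C)] : Prop
    extends IsEtaleGroupoid C where
  totallyDisconnected : TotallyDisconnectedSpace (Arrows.unitSpace C)

section Dynamics

variable (C : Type u) [Groupoid.{v} C]

/-- The set of units whose isotropy group is trivial. -/
def trivialIsotropy : Set (Arrows.unitSpace C) :=
  {x | ∀ α : Arrows C, Arrows.s α = x → Arrows.r α = x → α = x}

variable {C} in
/-- A set of units is invariant if it contains the range of each arrow whose source it contains. -/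
def IsInvariantUnits (D : Set (Arrows.unitSpace C)) : Prop :=
  ∀ α : Arrows C, Arrows.s α ∈ D → Arrows.r α ∈ D

/-- Minimality: the only open invariant sets of units are the empty set and the unit space. -/
def IsMinimalGroupoid [TopologicalSpace (Arrows C)] : Prop :=
  ∀ D : Set (Arrows.unitSpace C), IsOpen D → IsInvariantUnits D → D = ∅ ∨ D = Set.univ

/-- The units with trivial isotropy are dense in the unit space. -/
def IsTopologicallyPrincipal [TopologicalSpace (Arrows C)] : Prop :=
  Dense (trivialIsotropy C)

end Dynamics

/-- Invariance of the set of units with trivial isotropy, in both directions. -/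
theorem trivialIsotropy_iff {C : Type u} [Groupoid.{v} C] (α : Arrows C) :
    Arrows.s α ∈ trivialIsotropy C ↔ Arrows.r α ∈ trivialIsotropy C := by
  have key : ∀ (x : C), Arrows.s (Arrows.unit x) ∈ trivialIsotropy C ↔
      ∀ f : x ⟶ x, f = 𝟙 x := by
    intro x
    constructor
    · intro h f
      have := h ⟨x, x, f⟩ rfl rfl
      simpa [Arrows.s, Arrows.unit] using this
    · rintro h ⟨a, b, f⟩ h1 h2
      obtain rfl : a = x := Arrows.s_eq_s.1 h1
      obtain rfl : a = b := Arrows.s_eq_r.1 h2.symm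
      rw [h f]; rfl
  obtain ⟨a, b, f⟩ := α
  refine (key a).trans (Iff.trans ?_ (key b).symm)
  constructor
  · intro h g
    have := h (f ≫ g ≫ Groupoid.inv f)
    calc g = Groupoid.inv f ≫ (f ≫ g ≫ Groupoid.inv f) ≫ f := by simp
      _ = 𝟙 b := by rw [this]; simp
  · intro h g
    have := h (Groupoid.inv f ≫ g ≫ f)
    calc g = f ≫ (Groupoid.inv f ≫ g ≫ f) ≫ Groupoid.inv f := by simp
      _ = 𝟙 a := by rw [this]; simp

/-! ### Compact open bisections -/

/-- A bisection: source and range map restrict to homeomorphisms onto their images. -/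
def IsBisection {C : Type u} [Groupoid.{v} C] [TopologicalSpace (Arrows C)]
    (U : Set (Arrows C)) : Prop :=
  Topology.IsEmbedding (U.domRestrict Arrows.s) ∧ Topology.IsEmbedding (U.domRestrict Arrows.r)

/-- A compact open bisection. -/
structure IsCompactOpenBisection {C : Type u} [Groupoid.{v} C] [TopologicalSpace (Arrows C)]
    (U : Set (Arrows C)) : Prop where
  isCompact : IsCompact U
  isOpen : IsOpen U
  isBisection : IsBisection U

/-- The product set `U V` of all defined products. -/
def Arrows.setMul {C : Type u} [Groupoid.{v} C] (U V : Set (Arrows C)) : Set (Arrows C) :=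
  {γ | ∃ α ∈ U, ∃ β ∈ V, ∃ h : α.src = β.tgt, α.comp β h = γ}

namespace IsCompactOpenBisection

variable {C : Type u} [Groupoid.{v} C] [TopologicalSpace (Arrows C)] {U V : Set (Arrows C)}

theorem eq_of_src (hU : IsCompactOpenBisection U) {α β : Arrows C} (hα : α ∈ U) (hβ : β ∈ U)
    (h : α.src = β.src) : α = β :=
  congrArg Subtype.val (hU.isBisection.1.injective (a₁ := ⟨α, hα⟩) (a₂ := ⟨β, hβ⟩)
    (Arrows.s_eq_s.2 h))

theorem eq_of_tgt (hU : IsCompactOpenBisection U) {α β : Arrows C} (hα : α ∈ U) (hβ : β ∈ U)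
    (h : α.tgt = β.tgt) : α = β :=
  congrArg Subtype.val (hU.isBisection.2.injective (a₁ := ⟨α, hα⟩) (a₂ := ⟨β, hβ⟩)
    (Arrows.r_eq_r.2 h))

/-- The product of two compact open bisections is a compact open bisection. -/
theorem setMul [IsEtaleGroupoid C] (hU : IsCompactOpenBisection U)
    (hV : IsCompactOpenBisection V) : IsCompactOpenBisection (Arrows.setMul U V) := by
  have hs : IsLocalHomeomorph (Arrows.s : Arrows C → _) := IsEtaleGroupoid.isLocalHomeomorph_s
  have hr : IsLocalHomeomorph (Arrows.r : Arrows C → _) := IsEtaleGroupoid.isLocalHomeomorph_r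
  have hcomp := IsTopologicalGroupoid.continuous_comp (C := C)
  have hinv := IsTopologicalGroupoid.continuous_inv (C := C)
  have : T2Space (Arrows.unitSpace C) := IsEtaleGroupoid.hausdorff
  have hopen : IsOpen (Arrows.setMul U V) := by
    let e := hV.isBisection.1.toHomeomorph
    let W : Set (Arrows C) := Arrows.s ⁻¹' (Set.range (V.domRestrict Arrows.s))
    have hW : IsOpen W := by
      refine IsOpen.preimage hs.continuous ?_
      rw [Set.range_domRestrict]
      exact hs.isOpenMap _ hV.isOpen
    let σ : W → V := fun γ => e.symm ⟨Arrows.s γ.1, γ.2⟩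
    have hσc : Continuous σ := e.symm.continuous.comp
      ((hs.continuous.comp continuous_subtype_val).subtype_mk _)
    have hσ : ∀ γ : W, γ.1.src = (σ γ).1.src := by
      intro γ
      have : e (σ γ) = ⟨Arrows.s γ.1, γ.2⟩ := e.apply_symm_apply _
      exact (Arrows.s_eq_s.1 (congrArg Subtype.val this)).symm
    let φ : W → Arrows C := fun γ => γ.1.comp (σ γ).1.inv (hσ γ)
    have hφ : Continuous φ := by
      have h1 : Continuous fun γ : W =>
          (⟨(γ.1, (σ γ).1.inv), hσ γ⟩ :
            {p : Arrows C × Arrows C // p.1.src = p.2.tgt}) :=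
        Continuous.subtype_mk (continuous_subtype_val.prodMk
          (hinv.comp (continuous_subtype_val.comp hσc))) _
      exact hcomp.comp h1
    have heq : Arrows.setMul U V = Subtype.val '' (φ ⁻¹' U) := by
      ext γ
      constructor
      · rintro ⟨α, hα, β, hβ, h, rfl⟩
        have hw : α.comp β h ∈ W := ⟨⟨β, hβ⟩, Arrows.s_eq_s.2 rfl⟩
        refine ⟨⟨_, hw⟩, ?_, rfl⟩
        have h2 : (σ ⟨_, hw⟩).1 = β :=
          hV.eq_of_src (σ ⟨_, hw⟩).2 hβ (hσ ⟨_, hw⟩).symm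
        have h3 : φ ⟨_, hw⟩ = α := by
          simp only [φ, h2]
          exact Arrows.comp_inv_comp α β h
        rw [Set.mem_preimage, h3]
        exact hα
      · rintro ⟨γ, hγ, rfl⟩
        exact ⟨φ γ, hγ, (σ γ).1, (σ γ).2, rfl, Arrows.comp_comp_inv _ _ (hσ γ)⟩
    rw [heq]
    exact hW.isOpenMap_subtype_val _ (hU.isOpen.preimage hφ)
  have hcompact : IsCompact (Arrows.setMul U V) := by
    have hcl : IsClosed {p : Arrows C × Arrows C | p.1.src = p.2.tgt} := by
      have : {p : Arrows C × Arrows C | p.1.src = p.2.tgt} =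
          {p | Arrows.s p.1 = Arrows.r p.2} := by
        ext p; exact Arrows.s_eq_r.symm
      rw [this]
      exact isClosed_eq (hs.continuous.comp continuous_fst) (hr.continuous.comp continuous_snd)
    have h1 : IsCompact ((Subtype.val :
        {p : Arrows C × Arrows C // p.1.src = p.2.tgt} → _) ⁻¹' (U ×ˢ V)) :=
      hcl.isClosedEmbedding_subtypeVal.isCompact_preimage (hU.isCompact.prod hV.isCompact)
    have heq : Arrows.setMul U V = (fun p : {p : Arrows C × Arrows C // p.1.src = p.2.tgt} =>
        p.1.1.comp p.1.2 p.2) '' (Subtype.val ⁻¹' (U ×ˢ V)) := by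
      ext γ
      constructor
      · rintro ⟨α, hα, β, hβ, h, rfl⟩
        exact ⟨⟨(α, β), h⟩, ⟨hα, hβ⟩, rfl⟩
      · rintro ⟨⟨⟨α, β⟩, h⟩, ⟨hα, hβ⟩, rfl⟩
        exact ⟨α, hα, β, hβ, h, rfl⟩
    rw [heq]
    exact h1.image hcomp
  refine ⟨hcompact, hopen, ?_, ?_⟩
  · refine (Topology.IsOpenEmbedding.of_continuous_injective_isOpenMap
      (hs.continuous.comp continuous_subtype_val) ?_
      (hs.isOpenMap.comp hopen.isOpenMap_subtype_val)).isEmbedding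
    rintro ⟨_, α, hα, β, hβ, h, rfl⟩ ⟨_, α', hα', β', hβ', h', rfl⟩ he
    have h1 : β = β' := hV.eq_of_src hβ hβ' (Arrows.s_eq_s.1 he)
    subst h1
    have h2 : α = α' := hU.eq_of_src hα hα' (h.trans h'.symm)
    subst h2
    rfl
  · refine (Topology.IsOpenEmbedding.of_continuous_injective_isOpenMap
      (hr.continuous.comp continuous_subtype_val) ?_
      (hr.isOpenMap.comp hopen.isOpenMap_subtype_val)).isEmbedding
    rintro ⟨_, α, hα, β, hβ, h, rfl⟩ ⟨_, α', hα', β', hβ', h', rfl⟩ he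
    have h1 : α = α' := hU.eq_of_tgt hα hα' (Arrows.r_eq_r.1 he)
    subst h1
    have h2 : β = β' := hV.eq_of_tgt hβ hβ' (h.symm.trans h')
    subst h2
    rfl

end IsCompactOpenBisection

/-! ### The Steinberg algebra -/

section Steinberg

variable {S : Type w} [CommSemiring S] {C : Type u} [Groupoid.{v} C]

/-- The pairs of composable arrows with product `γ`. -/
def Arrows.Factorization (γ : Arrows C) : Type (max u v) :=
  {p : Arrows C × Arrows C // ∃ h : p.1.src = p.2.tgt, p.1.comp p.2 h = γ}

/-- The convolution product; `finsum` is a genuine finite sum for elements of the Steinberg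
algebra, see `finite_support_conv`. -/
noncomputable def conv (f g : Arrows C → S) (γ : Arrows C) : S :=
  ∑ᶠ p : Arrows.Factorization γ, f p.1.1 * g p.1.2

theorem conv_zero_left (g : Arrows C → S) : conv 0 g = 0 := by
  funext γ
  simp [conv]

theorem conv_zero_right (f : Arrows C → S) : conv f 0 = 0 := by
  funext γ
  simp [conv]

variable (S C) [TopologicalSpace (Arrows C)]

/-- The module of functions spanned by the characteristic functions of compact open bisections. -/
def steinbergModule : Submodule S (Arrows C → S) :=
  Submodule.span S {f | ∃ U : Set (Arrows C), IsCompactOpenBisection U ∧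
    f = U.indicator fun _ => 1}

variable {S C}

theorem finite_support_conv {f : Arrows C → S} (hf : f ∈ steinbergModule S C)
    (g : Arrows C → S) (γ : Arrows C) :
    (Function.support fun p : Arrows.Factorization γ => f p.1.1 * g p.1.2).Finite := by
  have hfin : ∀ x : C, {α : Arrows C | α.tgt = x ∧ f α ≠ 0}.Finite := by
    intro x
    induction hf using Submodule.span_induction with
    | mem f hf =>
      obtain ⟨U, hU, rfl⟩ := hf
      refine Set.Subsingleton.finite ?_
      rintro α ⟨h1, h2⟩ β ⟨h3, h4⟩
      exact hU.eq_of_tgt (Set.mem_of_indicator_ne_zero h2) (Set.mem_of_indicator_ne_zero h4)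
        (h1.trans h3.symm)
    | zero => simp
    | add f f' _ _ h h' =>
      refine (h.union h').subset ?_
      rintro α ⟨h1, h2⟩
      by_cases h0 : f α = 0
      · refine Or.inr ⟨h1, fun h3 => h2 ?_⟩
        simp [h0, h3]
      · exact Or.inl ⟨h1, h0⟩
    | smul a f _ h =>
      refine h.subset ?_
      rintro α ⟨h1, h2⟩
      refine ⟨h1, fun h3 => h2 ?_⟩
      simp [h3]
  refine Set.Finite.of_finite_image (f := fun p : Arrows.Factorization γ => p.1.1)
    ((hfin γ.tgt).subset ?_) ?_
  · rintro _ ⟨⟨⟨α, β⟩, h, rfl⟩, h2, rfl⟩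
    exact ⟨rfl, left_ne_zero_of_mul h2⟩
  · rintro ⟨⟨α, β⟩, h, hc⟩ _ ⟨⟨α', β'⟩, h', hc'⟩ _ (he : α = α')
    subst he
    have : β = β' := by
      rw [← Arrows.inv_comp_comp α β h, ← Arrows.inv_comp_comp α β' h']
      simp only at hc hc'
      simp only [hc, hc']
    subst this
    rfl

theorem conv_add_left {f f' : Arrows C → S} (hf : f ∈ steinbergModule S C)
    (hf' : f' ∈ steinbergModule S C) (g : Arrows C → S) :
    conv (f + f') g = conv f g + conv f' g := by
  funext γ
  simp only [conv, Pi.add_apply, add_mul]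
  exact finsum_add_distrib (finite_support_conv hf g γ) (finite_support_conv hf' g γ)

theorem conv_add_right {f : Arrows C → S} (hf : f ∈ steinbergModule S C)
    (g g' : Arrows C → S) : conv f (g + g') = conv f g + conv f g' := by
  funext γ
  simp only [conv, Pi.add_apply, mul_add]
  exact finsum_add_distrib (finite_support_conv hf g γ) (finite_support_conv hf g' γ)

theorem conv_smul_left (a : S) {f : Arrows C → S} (hf : f ∈ steinbergModule S C)
    (g : Arrows C → S) : conv (a • f) g = a • conv f g := by
  funext γ
  simp only [conv, Pi.smul_apply, smul_eq_mul, mul_assoc]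
  exact (mul_finsum' _ _ (finite_support_conv hf g γ)).symm

theorem conv_smul_right (a : S) {f : Arrows C → S} (hf : f ∈ steinbergModule S C)
    (g : Arrows C → S) : conv f (a • g) = a • conv f g := by
  funext γ
  simp only [conv, Pi.smul_apply, smul_eq_mul, mul_left_comm _ a]
  exact (mul_finsum' _ _ (finite_support_conv hf g γ)).symm

/-- `1_U * 1_V = 1_{UV}`. -/
theorem conv_indicator {U V : Set (Arrows C)} (hU : IsCompactOpenBisection U) :
    conv (U.indicator fun _ => (1 : S)) (V.indicator fun _ => (1 : S)) =
      (Arrows.setMul U V).indicator fun _ => (1 : S) := by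
  classical
  funext γ
  by_cases hγ : γ ∈ Arrows.setMul U V
  · obtain ⟨α, hα, β, hβ, h, rfl⟩ := id hγ
    rw [Set.indicator_of_mem hγ, conv, finsum_eq_single _ ⟨(α, β), h, rfl⟩]
    · simp [hα, hβ]
    · rintro ⟨⟨α', β'⟩, h', hc⟩ hne
      by_contra h0
      have hα' : α' ∈ U := Set.mem_of_indicator_ne_zero (left_ne_zero_of_mul h0)
      have h1 : α' = α := hU.eq_of_tgt hα' hα (show (α'.comp β' h').tgt = (α.comp β h).tgt from congrArg Arrows.tgt hc)
      subst h1
      have h2 : β' = β := by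
        rw [← Arrows.inv_comp_comp α' β' h', ← Arrows.inv_comp_comp α' β h]
        simp only at hc
        simp only [hc]
      subst h2
      exact hne rfl
  · rw [Set.indicator_of_notMem hγ, conv]
    refine finsum_eq_zero_of_forall_eq_zero ?_
    rintro ⟨⟨α, β⟩, h, hc⟩
    by_contra h0
    exact hγ ⟨α, Set.mem_of_indicator_ne_zero (left_ne_zero_of_mul h0), β,
      Set.mem_of_indicator_ne_zero (right_ne_zero_of_mul h0), h, hc⟩

theorem conv_mem [IsEtaleGroupoid C] {f g : Arrows C → S} (hf : f ∈ steinbergModule S C)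
    (hg : g ∈ steinbergModule S C) : conv f g ∈ steinbergModule S C := by
  induction hf using Submodule.span_induction with
  | mem f hf =>
    have hf' : f ∈ steinbergModule S C := Submodule.subset_span hf
    induction hg using Submodule.span_induction with
    | mem g hg =>
      obtain ⟨U, hU, rfl⟩ := hf
      obtain ⟨V, hV, rfl⟩ := hg
      exact Submodule.subset_span ⟨_, hU.setMul hV, conv_indicator hU⟩
    | zero => rw [conv_zero_right]; exact Submodule.zero_mem _
    | add g g' _ _ h h' => rw [conv_add_right hf']; exact Submodule.add_mem _ h h'
    | smul a g _ h => rw [conv_smul_right a hf']; exact Submodule.smul_mem _ a h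
  | zero => rw [conv_zero_left]; exact Submodule.zero_mem _
  | add f f' hf hf' h h' => rw [conv_add_left hf hf']; exact Submodule.add_mem _ h h'
  | smul a f hf h => rw [conv_smul_left a hf]; exact Submodule.smul_mem _ a h

theorem conv_assoc [IsEtaleGroupoid C] {f g k : Arrows C → S} (hf : f ∈ steinbergModule S C)
    (hg : g ∈ steinbergModule S C) (hk : k ∈ steinbergModule S C) :
    conv (conv f g) k = conv f (conv g k) := by
  induction hf using Submodule.span_induction with
  | mem f hf =>
    have hf' : f ∈ steinbergModule S C := Submodule.subset_span hf
    induction hg using Submodule.span_induction with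
    | mem g hg =>
      have hg' : g ∈ steinbergModule S C := Submodule.subset_span hg
      have hfg := conv_mem hf' hg'
      induction hk using Submodule.span_induction with
      | mem k hk =>
        obtain ⟨U, hU, rfl⟩ := hf
        obtain ⟨V, hV, rfl⟩ := hg
        obtain ⟨W, hW, rfl⟩ := hk
        rw [conv_indicator hU, conv_indicator (hU.setMul hV), conv_indicator hV,
          conv_indicator hU]
        congr 1
        ext γ
        constructor
        · rintro ⟨_, ⟨α, hα, β, hβ, h, rfl⟩, δ, hδ, h', rfl⟩
          exact ⟨α, hα, _, ⟨β, hβ, δ, hδ, h', rfl⟩, h, (Arrows.comp_assoc α β δ h h').symm⟩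
        · rintro ⟨α, hα, _, ⟨β, hβ, δ, hδ, h', rfl⟩, h, rfl⟩
          exact ⟨_, ⟨α, hα, β, hβ, h, rfl⟩, δ, hδ, h', Arrows.comp_assoc α β δ h h'⟩
      | zero => simp only [conv_zero_right]
      | add k k' _ _ h h' =>
        rw [conv_add_right hfg, conv_add_right hg', conv_add_right hf', h, h']
      | smul a k _ h =>
        rw [conv_smul_right a hfg, conv_smul_right a hg', conv_smul_right a hf', h]
    | zero => simp only [conv_zero_right, conv_zero_left]
    | add g g' hg hg' h h' =>
      rw [conv_add_right hf', conv_add_left (conv_mem hf' hg) (conv_mem hf' hg'),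
        conv_add_left hg hg', conv_add_right hf', h, h']
    | smul a g hg h =>
      rw [conv_smul_right a hf', conv_smul_left a (conv_mem hf' hg), conv_smul_left a hg,
        conv_smul_right a hf', h]
  | zero => simp only [conv_zero_left]
  | add f f' hf hf' h h' =>
    rw [conv_add_left hf hf', conv_add_left (conv_mem hf hg) (conv_mem hf' hg),
      conv_add_left hf hf', h, h']
  | smul a f hf h =>
    rw [conv_smul_left a hf, conv_smul_left a (conv_mem hf hg), conv_smul_left a hf, h]

variable (S C)

/-- The Steinberg algebra `A_S(G)` of the groupoid `G` of arrows of `C`, with pointwise addition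
and convolution as multiplication. -/
def SteinbergAlgebra : Type (max u v w) := steinbergModule S C

namespace SteinbergAlgebra

noncomputable instance : AddCommMonoid (SteinbergAlgebra S C) :=
  inferInstanceAs (AddCommMonoid (steinbergModule S C))

noncomputable instance : Module S (SteinbergAlgebra S C) :=
  inferInstanceAs (Module S (steinbergModule S C))

noncomputable instance [IsAmpleGroupoid C] : NonUnitalSemiring (SteinbergAlgebra S C) where
  mul f g := ⟨conv f.1 g.1, conv_mem f.2 g.2⟩
  left_distrib f g k := Subtype.ext (conv_add_right f.2 g.1 k.1)
  right_distrib f g k := Subtype.ext (conv_add_left f.2 g.2 k.1)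
  zero_mul f := Subtype.ext (conv_zero_left f.1)
  mul_zero f := Subtype.ext (conv_zero_right f.1)
  mul_assoc f g k := Subtype.ext (conv_assoc f.2 g.2 k.2)

instance [IsAmpleGroupoid C] : IsScalarTower S (SteinbergAlgebra S C) (SteinbergAlgebra S C) :=
  ⟨fun a f g => Subtype.ext (conv_smul_left a f.2 g.1)⟩

instance [IsAmpleGroupoid C] : SMulCommClass S (SteinbergAlgebra S C) (SteinbergAlgebra S C) :=
  ⟨fun a f g => Subtype.ext (conv_smul_right a f.2 g.1).symm⟩

end SteinbergAlgebra

/-- The congruence that identifies `f` and `g` if `f α = g α` for all arrows `α` whose source and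
range have trivial isotropy. -/
noncomputable def steinbergCon [IsAmpleGroupoid C] : RingCon (SteinbergAlgebra S C) where
  r f g := ∀ α : Arrows C, Arrows.s α ∈ trivialIsotropy C → Arrows.r α ∈ trivialIsotropy C →
    f.1 α = g.1 α
  iseqv := ⟨fun _ _ _ _ => rfl, fun h α h1 h2 => (h α h1 h2).symm,
    fun h h' α h1 h2 => (h α h1 h2).trans (h' α h1 h2)⟩
  add' := fun h h' α h1 h2 => congrArg₂ (· + ·) (h α h1 h2) (h' α h1 h2)
  mul' := by
    intro f f' g g' h h' γ h1 h2
    refine finsum_congr ?_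
    rintro ⟨⟨α, β⟩, hc, rfl⟩
    have hβ : Arrows.s β ∈ trivialIsotropy C := h1
    have hα : Arrows.r α ∈ trivialIsotropy C := h2
    exact congrArg₂ (· * ·) (h α ((trivialIsotropy_iff α).2 hα) hα)
      (h' β hβ ((trivialIsotropy_iff β).1 hβ))

end Steinberg

/-! ### Congruence-simplicity -/

/-- A hemiring is congruence-simple if its only congruences are the diagonal one `⊥` and the full
one `⊤`. -/
def IsCongruenceSimple (R : Type*) [NonUnitalSemiring R] : Prop :=
  ∀ c : RingCon R, c = ⊥ ∨ c = ⊤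

/-!
For a groupoid that is minimal and has a unit with trivial isotropy, `A_S(G)/≡` is
congruence-simple if and only if `S` is. Indeed, a congruence that is not contained in `≡` relates
two functions with different values `a ≠ b` at an arrow `α` whose ends have trivial isotropy.
Multiplying by a bisection through `α⁻¹` moves `α` to the unit `s α`, and cutting down by a small
compact open neighbourhood `V` of that unit on both sides leaves `a • 1_V ~ b • 1_V`. If `S` is
congruence-simple, this forces `1_V ~ 0`, and minimality spreads the relation `1_W ~ 0` to all
compact open sets `W` of units, which act as local units. Conversely, a congruence `c` on `S` is
recovered from the pullback of `≡` along the base change `A_S(G) → A_{S/c}(G)`.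

A nontrivial commutative semiring `S` that is congruence-simple has no zero divisors, and
identifying elements that differ by an additive unit is either the full congruence, whence `S` is a
ring and so a field, or the diagonal one, whence sums of nonzero elements are nonzero and
`a ↦ [a ≠ 0]` is an injective homomorphism to `𝔹`.
-/

open Function

/-! ### Congruence-simple semirings -/

namespace IsCongruenceSimple

theorem of_surjective {R R' : Type*} [NonUnitalSemiring R] [NonUnitalSemiring R']
    (h : IsCongruenceSimple R) (f : R →ₙ+* R') (hf : Surjective f) : IsCongruenceSimple R' := by
  refine fun c => (h (c.comap f)).imp (fun hc => ?_) fun hc => ?_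
  · refine le_bot_iff.1 fun x y hxy => ?_
    obtain ⟨⟨a, rfl⟩, b, rfl⟩ := And.intro (hf x) (hf y)
    exact congrArg f (hc.le (RingCon.comap_rel.2 hxy))
  · refine top_le_iff.1 fun x y _ => ?_
    obtain ⟨⟨a, rfl⟩, b, rfl⟩ := And.intro (hf x) (hf y)
    exact RingCon.comap_rel.1 (hc.ge trivial)

theorem of_ringEquiv {R R' : Type*} [NonUnitalSemiring R] [NonUnitalSemiring R']
    (h : IsCongruenceSimple R) (e : R ≃+* R') : IsCongruenceSimple R' :=
  h.of_surjective (e : R →ₙ+* R') e.surjective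

end IsCongruenceSimple

theorem isCongruenceSimple_quotient_iff {R : Type*} [NonUnitalSemiring R] {c : RingCon R} :
    IsCongruenceSimple c.Quotient ↔ ∀ d, c ≤ d → d = c ∨ d = ⊤ := by
  constructor
  · intro h d hcd
    let factor : c.Quotient →ₙ+* d.Quotient :=
      { toFun := Quotient.map' id hcd
        map_mul' := by rintro ⟨x⟩ ⟨y⟩; rfl
        map_zero' := rfl
        map_add' := by rintro ⟨x⟩ ⟨y⟩; rfl }
    refine (h ((⊥ : RingCon d.Quotient).comap factor)).imp (fun hd => ?_) fun hd => ?_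
    · exact hcd.antisymm' fun x y hxy =>
        c.eq.1 (hd.le (show (⊥ : RingCon _).comap factor x y from d.eq.2 hxy))
    · exact top_le_iff.1 fun x y _ =>
        d.eq.1 (show (⊥ : RingCon _).comap factor x y from hd.ge trivial)
  · intro h e
    let mk : R →ₙ+* c.Quotient :=
      { toFun := (↑), map_mul' := c.coe_mul, map_zero' := c.coe_zero, map_add' := c.coe_add }
    have hmk : Surjective mk := Quotient.mk''_surjective
    have hc : (⊥ : RingCon c.Quotient).comap mk = c := RingCon.ext fun _ _ => c.eq
    have hle : c ≤ e.comap mk := hc.ge.trans (RingCon.comap_mono bot_le)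
    refine (h (e.comap mk) hle).imp (fun he => ?_) fun he => ?_
    · exact RingCon.comap_injective mk hmk (he.trans hc.symm)
    · exact RingCon.comap_injective mk hmk he

theorem isCongruenceSimple_iff_isSimpleRing {R : Type*} [Ring R] [Nontrivial R] :
    IsCongruenceSimple R ↔ IsSimpleRing R := by
  refine ⟨fun h => ⟨?_⟩, fun h => ?_⟩
  · have : IsSimpleOrder (RingCon R) := ⟨h⟩
    exact TwoSidedIdeal.orderIsoRingCon.isSimpleOrder
  · have := h.simple
    have : IsSimpleOrder (RingCon R) := TwoSidedIdeal.orderIsoRingCon.symm.isSimpleOrder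
    exact eq_bot_or_eq_top

theorem BoolSemifield.isCongruenceSimple : IsCongruenceSimple BoolSemifield := by
  intro c
  by_cases h : c 0 1
  · exact .inr <| top_le_iff.1 fun a b _ => by
      have h' (a : BoolSemifield) : c 0 a := by
        simpa only [zero_mul, one_mul] using c.mul h (c.refl a)
      exact c.trans (c.symm (h' a)) (h' b)
  · refine .inl <| le_bot_iff.1 fun a b hab => ?_
    cases a <;> cases b
    exacts [rfl, absurd hab h, absurd (c.symm hab) h, rfl]

section CommSemiring

variable {S : Type*} [CommSemiring S]

/-- The congruence "`a * x = a * y`". -/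
def mulLeftCon (a : S) : RingCon S where
  r x y := a * x = a * y
  iseqv := ⟨fun _ => rfl, Eq.symm, Eq.trans⟩
  mul' {w x y z} h h' := by
    rw [← mul_assoc, h, mul_right_comm, h', mul_right_comm, mul_assoc]
  add' {w x y z} h h' := by rw [mul_add, h, h', mul_add]

variable (S) in
/-- The congruence identifying elements that differ by an additive unit. -/
def addUnitCon : RingCon S where
  r x y := ∃ u, IsAddUnit u ∧ x + u = y
  iseqv :=
    { refl x := ⟨0, isAddUnit_zero, add_zero x⟩
      symm := by
        rintro x _ ⟨_, ⟨u, rfl⟩, rfl⟩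
        exact ⟨_, (-u).isAddUnit, u.add_neg_cancel_right x⟩
      trans := by
        rintro x _ _ ⟨u, hu, rfl⟩ ⟨v, hv, rfl⟩
        exact ⟨u + v, hu.add hv, (add_assoc x u v).symm⟩ }
  mul' := by
    rintro w _ y _ ⟨u, hu, rfl⟩ ⟨v, hv, rfl⟩
    exact ⟨w * v + u * (y + v), (hv.mul_left w).add (hu.mul_right _), by ring⟩
  add' := by
    rintro w _ y _ ⟨u, hu, rfl⟩ ⟨v, hv, rfl⟩
    exact ⟨u + v, hu.add hv, add_add_add_comm w y u v⟩

namespace IsCongruenceSimple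

theorem noZeroDivisors [Nontrivial S] (h : IsCongruenceSimple S) : NoZeroDivisors S where
  eq_zero_or_eq_zero_of_mul_eq_zero {a b} hab := by
    rcases h (mulLeftCon a) with ha | ha
    · exact .inr (ha.le (show a * b = a * 0 by rw [hab, mul_zero]))
    · have : a * 1 = a * 0 := ha.ge trivial
      exact .inl (by simpa only [mul_one, mul_zero] using this)

theorem eq_zero_of_isAddUnit (h : IsCongruenceSimple S) (h1 : ¬IsAddUnit (1 : S)) {a : S}
    (ha : IsAddUnit a) : a = 0 := by
  rcases h (addUnitCon S) with hS | hS
  · exact (hS.le ⟨a, ha, zero_add a⟩ : (0 : S) = a).symm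
  · obtain ⟨u, hu, hu'⟩ : ∃ u : S, IsAddUnit u ∧ 0 + u = 1 := hS.ge trivial
    exact absurd (by rwa [← hu', zero_add]) h1

end IsCongruenceSimple

open scoped Classical in
/-- The indicator of the nonzero elements, which is a homomorphism to the Boolean semifield when
nonzero elements are closed under addition and multiplication. -/
noncomputable def toBoolSemifield [Nontrivial S] [NoZeroDivisors S]
    (hadd : ∀ a b : S, a + b = 0 → a = 0) : S →+* BoolSemifield where
  toFun a := if a = 0 then 0 else 1
  map_zero' := if_pos rfl
  map_one' := if_neg one_ne_zero
  map_mul' a b := by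
    by_cases ha : a = 0 <;> by_cases hb : b = 0 <;> simp [ha, hb]
  map_add' a b := by
    have hab : a + b = 0 ↔ a = 0 ∧ b = 0 :=
      ⟨fun h => ⟨hadd a b h, hadd b a (add_comm a b ▸ h)⟩, fun h => by rw [h.1, h.2, add_zero]⟩
    by_cases ha : a = 0 <;> by_cases hb : b = 0 <;> simp [hab, ha, hb]; rfl

namespace IsCongruenceSimple

theorem nonempty_ringEquiv_boolSemifield [Nontrivial S] (h : IsCongruenceSimple S)
    (h1 : ¬IsAddUnit (1 : S)) : Nonempty (S ≃+* BoolSemifield) := by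
  have := h.noZeroDivisors
  have hadd (a b : S) (hab : a + b = 0) : a = 0 :=
    h.eq_zero_of_isAddUnit h1 (isAddUnit_iff_exists_neg.2 ⟨b, hab⟩)
  let f := toBoolSemifield hadd
  have hf : Injective f := by
    rcases h (RingCon.ker f) with hker | hker
    · exact fun a b hab => hker.le hab
    · have h01 : f 0 = f 1 := hker.ge trivial
      rw [map_zero, map_one] at h01
      exact absurd h01 zero_ne_one
  have hf' : Surjective f
    | false => ⟨0, map_zero f⟩
    | true => ⟨1, map_one f⟩
  exact ⟨RingEquiv.ofBijective f ⟨hf, hf'⟩⟩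

end IsCongruenceSimple

end CommSemiring

theorem IsCongruenceSimple.exists_field_ringEquiv {S : Type w} [CommSemiring S] [Nontrivial S]
    (h : IsCongruenceSimple S) (h1 : IsAddUnit (1 : S)) :
    ∃ (F : Type w) (_ : Field F), Nonempty (S ≃+* F) := by
  obtain ⟨n, hn⟩ := isAddUnit_iff_exists_neg'.1 h1
  let _ : Neg S := ⟨fun a => n * a⟩
  let _ : CommRing S :=
    { ‹CommSemiring S› with
      zsmul := zsmulRec
      neg_add_cancel a := by
        change n * a + a = 0
        rw [← add_one_mul, hn, zero_mul] }
  have hS : IsField S := (isSimpleRing_iff_isField S).1 (isCongruenceSimple_iff_isSimpleRing.1 h)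
  exact ⟨S, hS.toField, ⟨RingEquiv.refl S⟩⟩

theorem isCongruenceSimple_iff_field_or_boolSemifield {S : Type w} [CommSemiring S] [Nontrivial S] :
    IsCongruenceSimple S ↔
      (∃ (F : Type w) (_ : Field F), Nonempty (S ≃+* F)) ∨ Nonempty (S ≃+* BoolSemifield) := by
  refine ⟨fun h => ?_, ?_⟩
  · by_cases h1 : IsAddUnit (1 : S)
    · exact .inl (h.exists_field_ringEquiv h1)
    · exact .inr (h.nonempty_ringEquiv_boolSemifield h1)
  · rintro (⟨F, _, ⟨e⟩⟩ | ⟨⟨e⟩⟩)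
    · exact (isCongruenceSimple_iff_isSimpleRing.2 inferInstance).of_ringEquiv e.symm
    · exact BoolSemifield.isCongruenceSimple.of_ringEquiv e.symm

/-! ### The topology of ample groupoids -/

open TopologicalSpace

section Prespectral

variable {X Y : Type*} [TopologicalSpace X] [TopologicalSpace Y]

theorem prespectralSpace_of_totallyDisconnectedSpace [LocallyCompactSpace X] [T2Space X]
    [TotallyDisconnectedSpace X] : PrespectralSpace X where
  isTopologicalBasis := by
    refine isTopologicalBasis_of_isOpen_of_nhds (fun U hU => hU.1) fun x O hx hO => ?_
    obtain ⟨K, hK, hKO, hKc⟩ := local_compact_nhds (hO.mem_nhds hx)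
    obtain ⟨W, hW, hxW, hWK⟩ :=
      (loc_compact_Haus_tot_disc_of_zero_dim (H := X)).exists_subset_of_mem_open
        (mem_interior_iff_mem_nhds.2 hK) isOpen_interior
    have hWK : W ⊆ K := hWK.trans interior_subset
    exact ⟨W, ⟨hW.2, hKc.of_isClosed_subset hW.1 hWK⟩, hxW, hWK.trans hKO⟩

theorem prespectralSpace_of_isLocalHomeomorph [PrespectralSpace Y] {f : X → Y}
    (hf : IsLocalHomeomorph f) : PrespectralSpace X := by
  choose e he _ using hf
  let U (x : X) : Opens X := ⟨(e x).source, (e x).open_source⟩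
  have hU : IsOpenCover U := .mk (Opens.ext_iff.2 (Set.eq_univ_of_forall fun x => by
    rw [Opens.coe_iSup]
    exact Set.mem_iUnion.2 ⟨x, he x⟩))
  have (x : X) : PrespectralSpace (U x) := (e x).isOpenEmbedding_restrict.prespectralSpace
  exact .of_isOpenCover hU

theorem exists_compactOpens_between [PrespectralSpace X] {K O : Set X} (hK : IsCompact K)
    (hO : IsOpen O) (hKO : K ⊆ O) : ∃ W : CompactOpens X, K ⊆ W ∧ (W : Set X) ⊆ O := by
  obtain ⟨W, hW, hWo, hKW, hWO⟩ := PrespectralSpace.exists_isCompact_and_isOpen_between hK hO hKO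
  exact ⟨⟨⟨W, hW⟩, hWo⟩, hKW, hWO⟩

theorem exists_mem_compactOpens_subset [PrespectralSpace X] {x : X} {O : Set X} (hO : IsOpen O)
    (hx : x ∈ O) : ∃ W : CompactOpens X, x ∈ W ∧ (W : Set X) ⊆ O := by
  obtain ⟨W, hxW, hWO⟩ :=
    exists_compactOpens_between isCompact_singleton hO (Set.singleton_subset_iff.2 hx)
  exact ⟨W, Set.singleton_subset_iff.1 hxW, hWO⟩

theorem mem_opensEquiv_symm_iff [PrespectralSpace X] {I : Order.Ideal (CompactOpens X)} {x : X} :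
    x ∈ PrespectralSpace.opensEquiv.symm I ↔ ∃ W ∈ I, x ∈ W := by
  simp [PrespectralSpace.opensEquiv]

end Prespectral

attribute [instance] IsEtaleGroupoid.locallyCompact IsEtaleGroupoid.hausdorff
  IsAmpleGroupoid.totallyDisconnected

namespace Arrows

variable {C : Type u} [Groupoid.{v} C]

instance [Nonempty C] : Nonempty (unitSpace C) :=
  (Set.range_nonempty unit).to_subtype

theorem s_coe (y : unitSpace C) : s (y : Arrows C) = y := by
  obtain ⟨_, x, rfl⟩ := y
  rfl

theorem r_coe (y : unitSpace C) : r (y : Arrows C) = y := by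
  obtain ⟨_, x, rfl⟩ := y
  rfl

theorem inv_comp (α : Arrows C) : α.inv.comp α rfl = s α := by
  simp [comp, unit, inv, s]

theorem comp_inv (α : Arrows C) : α.comp α.inv rfl = r α := by
  simp [comp, unit, inv, r]

theorem coe_comp (α : Arrows C) (y : unitSpace C) (h : (y : Arrows C).src = α.tgt) :
    comp y α h = α := by
  obtain ⟨_, x, rfl⟩ := y
  obtain rfl : x = α.tgt := h
  simp [comp, unit]

theorem comp_left_cancel {α β β' : Arrows C} (h : α.src = β.tgt) (h' : α.src = β'.tgt)
    (hc : α.comp β h = α.comp β' h') : β = β' := by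
  rw [← inv_comp_comp α β h, ← inv_comp_comp α β' h']
  simp only [hc]

variable [TopologicalSpace (Arrows C)]

theorem continuous_s [IsEtaleGroupoid C] : Continuous (s : Arrows C → unitSpace C) :=
  IsEtaleGroupoid.isLocalHomeomorph_s.continuous

theorem continuous_r [IsEtaleGroupoid C] : Continuous (r : Arrows C → unitSpace C) :=
  IsEtaleGroupoid.isLocalHomeomorph_r.continuous

theorem isOpen_unitSpace [IsEtaleGroupoid C] : IsOpen (unitSpace C) := by
  have hs : IsLocalHomeomorph (s ∘ ((↑) : unitSpace C → Arrows C)) := by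
    rw [show s ∘ ((↑) : unitSpace C → Arrows C) = id from funext s_coe]
    exact (Homeomorph.refl _).isLocalHomeomorph
  have hval := hs.of_comp IsEtaleGroupoid.isLocalHomeomorph_s continuous_subtype_val
  simpa only [Subtype.range_coe] using hval.isOpenMap.isOpen_range

instance [IsAmpleGroupoid C] : PrespectralSpace (unitSpace C) :=
  prespectralSpace_of_totallyDisconnectedSpace

instance [IsAmpleGroupoid C] : PrespectralSpace (Arrows C) :=
  prespectralSpace_of_isLocalHomeomorph IsEtaleGroupoid.isLocalHomeomorph_s

end Arrows

section Bisections

variable {C : Type u} [Groupoid.{v} C] [TopologicalSpace (Arrows C)]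

theorem IsCompactOpenBisection.of_injOn [IsEtaleGroupoid C] {U : Set (Arrows C)}
    (hc : IsCompact U) (ho : IsOpen U) (hs : Set.InjOn Arrows.s U) (hr : Set.InjOn Arrows.r U) :
    IsCompactOpenBisection U := by
  have hval := ho.isOpenEmbedding_subtypeVal.isLocalHomeomorph
  refine ⟨hc, ho, ?_, ?_⟩
  · exact ((IsEtaleGroupoid.isLocalHomeomorph_s.comp hval).isOpenEmbedding_of_injective
      (Set.injOn_iff_injective.1 hs)).isEmbedding
  · exact ((IsEtaleGroupoid.isLocalHomeomorph_r.comp hval).isOpenEmbedding_of_injective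
      (Set.injOn_iff_injective.1 hr)).isEmbedding

theorem isCompactOpenBisection_compactOpens [IsEtaleGroupoid C]
    (W : CompactOpens (Arrows.unitSpace C)) :
    IsCompactOpenBisection (((↑) : Arrows.unitSpace C → Arrows C) '' W) := by
  refine .of_injOn (W.isCompact.image continuous_subtype_val)
    (Arrows.isOpen_unitSpace.isOpenMap_subtype_val _ W.isOpen) ?_ ?_
  · exact (LeftInverse.rightInvOn_range Arrows.s_coe).injOn.mono (Set.image_subset_range _ _)
  · exact (LeftInverse.rightInvOn_range Arrows.r_coe).injOn.mono (Set.image_subset_range _ _)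

theorem exists_isCompactOpenBisection_mem [IsAmpleGroupoid C] (γ : Arrows C) :
    ∃ U : Set (Arrows C), IsCompactOpenBisection U ∧ γ ∈ U := by
  obtain ⟨O, hO, hγO, hs⟩ :=
    (IsEtaleGroupoid.isLocalHomeomorph_s (C := C)).isLocallyInjective γ
  obtain ⟨O', hO', hγO', hr⟩ :=
    (IsEtaleGroupoid.isLocalHomeomorph_r (C := C)).isLocallyInjective γ
  obtain ⟨U, hγU, hUO⟩ := exists_mem_compactOpens_subset (hO.inter hO') ⟨hγO, hγO'⟩
  exact ⟨U, .of_injOn U.isCompact U.isOpen (hs.mono (hUO.trans Set.inter_subset_left))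
    (hr.mono (hUO.trans Set.inter_subset_right)), hγU⟩

theorem exists_compactOpens_disjoint_corner [IsAmpleGroupoid C] {U : Set (Arrows C)}
    (hU : IsCompact U) {x : Arrows.unitSpace C} (hx : x ∈ trivialIsotropy C)
    (hxU : (x : Arrows C) ∉ U) :
    ∃ V : CompactOpens (Arrows.unitSpace C), x ∈ V ∧
      ∀ α ∈ U, Arrows.s α ∈ V → Arrows.r α ∉ V := by
  let sr (α : Arrows C) := (Arrows.s α, Arrows.r α)
  have hclosed : IsClosed (sr '' U) :=
    (hU.image (Arrows.continuous_s.prodMk Arrows.continuous_r)).isClosed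
  have hxx : (x, x) ∉ sr '' U := by
    rintro ⟨α, hα, hαx⟩
    exact hxU (hx α (congrArg Prod.fst hαx) (congrArg Prod.snd hαx) ▸ hα)
  obtain ⟨O, O', hO, hO', hxO, hxO', hsub⟩ :=
    isOpen_prod_iff.1 hclosed.isOpen_compl x x hxx
  obtain ⟨V, hxV, hV⟩ := exists_mem_compactOpens_subset (hO.inter hO') ⟨hxO, hxO'⟩
  exact ⟨V, hxV, fun α hα hs hr => hsub ⟨(hV hs).1, (hV hr).2⟩ ⟨α, hα, rfl⟩⟩

end Bisections

/-! ### Characteristic functions in the Steinberg algebra -/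

namespace SteinbergAlgebra

variable {S : Type w} [CommSemiring S] {C : Type u} [Groupoid.{v} C] [TopologicalSpace (Arrows C)]

instance : FunLike (SteinbergAlgebra S C) (Arrows C) S where
  coe := Subtype.val
  coe_injective := Subtype.val_injective

theorem zero_apply (α : Arrows C) : (0 : SteinbergAlgebra S C) α = 0 := rfl

theorem add_apply (f g : SteinbergAlgebra S C) (α : Arrows C) : (f + g) α = f α + g α := rfl

theorem smul_apply (a : S) (f : SteinbergAlgebra S C) (α : Arrows C) : (a • f) α = a * f α := rfl

theorem mul_apply [IsAmpleGroupoid C] (f g : SteinbergAlgebra S C) (γ : Arrows C) :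
    (f * g) γ = ∑ᶠ p : γ.Factorization, f p.1.1 * g p.1.2 := rfl

variable (S) in
/-- The characteristic function of a compact open bisection. -/
noncomputable def char {U : Set (Arrows C)} (hU : IsCompactOpenBisection U) :
    SteinbergAlgebra S C :=
  ⟨U.indicator fun _ => 1, Submodule.subset_span ⟨U, hU, rfl⟩⟩

theorem char_apply_of_mem {U : Set (Arrows C)} (hU : IsCompactOpenBisection U) {α : Arrows C}
    (hα : α ∈ U) : char S hU α = 1 :=
  Set.indicator_of_mem (f := fun _ => (1 : S)) hα

theorem char_apply_of_notMem {U : Set (Arrows C)} (hU : IsCompactOpenBisection U) {α : Arrows C}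
    (hα : α ∉ U) : char S hU α = 0 :=
  Set.indicator_of_notMem (f := fun _ => (1 : S)) hα

theorem mem_of_char_apply_ne_zero {U : Set (Arrows C)} {hU : IsCompactOpenBisection U}
    {α : Arrows C} (hα : char S hU α ≠ 0) : α ∈ U :=
  not_imp_comm.1 (char_apply_of_notMem hU) hα

@[elab_as_elim]
theorem induction_on {p : SteinbergAlgebra S C → Prop} (f : SteinbergAlgebra S C)
    (char : ∀ (U : Set (Arrows C)) (hU : IsCompactOpenBisection U), p (char S hU)) (zero : p 0)
    (add : ∀ f g, p f → p g → p (f + g)) (smul : ∀ (a : S) f, p f → p (a • f)) : p f := by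
  obtain ⟨f, hf⟩ := f
  induction hf using Submodule.span_induction with
  | mem f hf =>
    obtain ⟨U, hU, rfl⟩ := hf
    exact char U hU
  | zero => exact zero
  | add f g _ _ hf hg => exact add _ _ hf hg
  | smul a f _ hf => exact smul a _ hf

theorem exists_compactOpens_r_mem [IsAmpleGroupoid C] (f : SteinbergAlgebra S C) :
    ∃ W : CompactOpens (Arrows.unitSpace C), ∀ α, f α ≠ 0 → Arrows.r α ∈ W := by
  induction f using induction_on with
  | char U hU =>
    obtain ⟨W, hUW, -⟩ := exists_compactOpens_between (hU.isCompact.image Arrows.continuous_r)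
      isOpen_univ (Set.subset_univ _)
    exact ⟨W, fun α hα => hUW ⟨α, mem_of_char_apply_ne_zero hα, rfl⟩⟩
  | zero => exact ⟨⊥, fun α hα => (hα (zero_apply α)).elim⟩
  | add f g hf hg =>
    obtain ⟨W, hW⟩ := hf
    obtain ⟨W', hW'⟩ := hg
    refine ⟨W ⊔ W', fun α hα => ?_⟩
    by_cases hfα : f α = 0
    · exact .inr (hW' α fun hgα => hα (by rw [add_apply, hfα, hgα, add_zero]))
    · exact .inl (hW α hfα)
  | smul a f hf =>
    obtain ⟨W, hW⟩ := hf
    exact ⟨W, fun α hα => hW α (right_ne_zero_of_mul hα)⟩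

variable (S) in
/-- The characteristic function of a compact open set of units. -/
noncomputable def unitChar [IsEtaleGroupoid C] (W : CompactOpens (Arrows.unitSpace C)) :
    SteinbergAlgebra S C :=
  char S (isCompactOpenBisection_compactOpens W)

theorem unitChar_apply_coe [IsEtaleGroupoid C] {W : CompactOpens (Arrows.unitSpace C)}
    {x : Arrows.unitSpace C} (hx : x ∈ W) : unitChar S W x = 1 :=
  char_apply_of_mem _ ⟨x, hx, rfl⟩

theorem unitChar_bot [IsEtaleGroupoid C] :
    unitChar S (⊥ : CompactOpens (Arrows.unitSpace C)) = 0 :=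
  DFunLike.ext _ _ fun _ => char_apply_of_notMem _ (by simp)

theorem unitChar_sup [IsEtaleGroupoid C] (V W : CompactOpens (Arrows.unitSpace C)) :
    unitChar S (V ⊔ W) = unitChar S V + unitChar S (W \ V) := by
  refine Subtype.ext ((congrArg (Set.indicator · fun _ => (1 : S)) ?_).trans
    (Set.indicator_union_of_disjoint
      ((Set.disjoint_image_iff Subtype.val_injective).2 Set.disjoint_sdiff_right) _))
  rw [← Set.image_union]
  exact congrArg _ Set.union_sdiff_self.symm

theorem eq_of_steinbergCon_smul_unitChar [IsAmpleGroupoid C]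
    {V : CompactOpens (Arrows.unitSpace C)} {x : Arrows.unitSpace C} (hx : x ∈ trivialIsotropy C)
    (hxV : x ∈ V) {a b : S} (h : steinbergCon S C (a • unitChar S V) (b • unitChar S V)) :
    a = b := by
  have hab : (a • unitChar S V) (x : Arrows C) = (b • unitChar S V) x :=
    h x (by rwa [Arrows.s_coe]) (by rwa [Arrows.r_coe])
  simpa only [smul_apply, unitChar_apply_coe hxV, mul_one] using hab

section Mul

variable [IsAmpleGroupoid C]

theorem char_mul_char {U V : Set (Arrows C)} (hU : IsCompactOpenBisection U)
    (hV : IsCompactOpenBisection V) : char S hU * char S hV = char S (hU.setMul hV) :=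
  Subtype.ext (conv_indicator hU)

theorem char_mul_apply_comp {B : Set (Arrows C)} (hB : IsCompactOpenBisection B)
    (f : SteinbergAlgebra S C) {α β : Arrows C} (hβ : β ∈ B) (h : β.src = α.tgt) :
    (char S hB * f) (β.comp α h) = f α := by
  rw [mul_apply, finsum_eq_single _ ⟨(β, α), h, rfl⟩, char_apply_of_mem hB hβ, one_mul]
  rintro ⟨⟨β', α'⟩, h', hcomp⟩ hne
  rw [char_apply_of_notMem hB, zero_mul]
  intro hβ'
  obtain rfl : β' = β := hB.eq_of_tgt hβ' hβ
    (show (β'.comp α' h').tgt = (β.comp α h).tgt from congrArg Arrows.tgt hcomp)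
  obtain rfl : α' = α := Arrows.comp_left_cancel h' h hcomp
  exact hne rfl

theorem char_mul_apply_of_notMem {B : Set (Arrows C)} (hB : IsCompactOpenBisection B)
    (f : SteinbergAlgebra S C) {γ : Arrows C} (hγ : Arrows.r γ ∉ Arrows.r '' B) :
    (char S hB * f) γ = 0 := by
  rw [mul_apply]
  refine finsum_eq_zero_of_forall_eq_zero fun p => ?_
  obtain ⟨⟨β, α⟩, h, rfl⟩ := p
  rw [char_apply_of_notMem hB fun hβ => hγ ⟨β, hβ, rfl⟩, zero_mul]

theorem unitChar_mul_apply_of_mem {W : CompactOpens (Arrows.unitSpace C)}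
    (f : SteinbergAlgebra S C) {γ : Arrows C} (hγ : Arrows.r γ ∈ W) :
    (unitChar S W * f) γ = f γ := by
  have h : (Arrows.r γ : Arrows C).comp γ rfl = γ := Arrows.coe_comp γ _ rfl
  exact (congrArg _ h).symm.trans
    (char_mul_apply_comp (isCompactOpenBisection_compactOpens W) f ⟨_, hγ, rfl⟩ rfl)

theorem unitChar_mul_apply_of_notMem {W : CompactOpens (Arrows.unitSpace C)}
    (f : SteinbergAlgebra S C) {γ : Arrows C} (hγ : Arrows.r γ ∉ W) :
    (unitChar S W * f) γ = 0 := by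
  refine char_mul_apply_of_notMem _ f ?_
  rintro ⟨_, ⟨y, hy, rfl⟩, hyγ⟩
  exact hγ (by rwa [← hyγ, Arrows.r_coe])

theorem unitChar_mul_eq_self {W : CompactOpens (Arrows.unitSpace C)} {f : SteinbergAlgebra S C}
    (hf : ∀ α, f α ≠ 0 → Arrows.r α ∈ W) : unitChar S W * f = f := by
  refine DFunLike.ext _ _ fun γ => ?_
  by_cases hγ : Arrows.r γ ∈ W
  · exact unitChar_mul_apply_of_mem f hγ
  · rw [unitChar_mul_apply_of_notMem f hγ, not_imp_comm.1 (hf γ) hγ]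

theorem unitChar_mul_unitChar_of_le {V W : CompactOpens (Arrows.unitSpace C)} (h : V ≤ W) :
    unitChar S W * unitChar S V = unitChar S V := by
  refine unitChar_mul_eq_self fun α hα => ?_
  obtain ⟨y, hy, rfl⟩ := mem_of_char_apply_ne_zero hα
  rw [Arrows.r_coe]
  exact h hy

theorem unitChar_mul_char {W : CompactOpens (Arrows.unitSpace C)} {U : Set (Arrows C)}
    (hU : IsCompactOpenBisection U) (h : ((↑) : Arrows.unitSpace C → Arrows C) '' W ⊆ U) :
    unitChar S W * char S hU = unitChar S W := by
  refine DFunLike.ext _ _ fun γ => ?_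
  by_cases hγ : γ ∈ ((↑) : Arrows.unitSpace C → Arrows C) '' W
  · obtain ⟨y, hy, rfl⟩ := hγ
    rw [unitChar_mul_apply_of_mem _ (by rwa [Arrows.r_coe]), char_apply_of_mem hU (h ⟨y, hy, rfl⟩),
      unitChar_apply_coe hy]
  · rw [unitChar, char_apply_of_notMem _ hγ, char_mul_char, char_apply_of_notMem]
    rintro ⟨_, ⟨y, hy, rfl⟩, β, hβ, hyβ, rfl⟩
    have hr : Arrows.r (y : Arrows C) = Arrows.r β := by
      rw [Arrows.r_coe, ← Arrows.s_eq_r.2 hyβ, Arrows.s_coe]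
    have hy' : (y : Arrows C) = β :=
      hU.eq_of_tgt (h ⟨y, hy, rfl⟩) hβ (Arrows.r_eq_r.1 hr)
    exact hγ ⟨y, hy, hy'.trans (Arrows.coe_comp β y hyβ).symm⟩

theorem exists_forall_le_unitChar_corner (f : SteinbergAlgebra S C) {x : Arrows.unitSpace C}
    (hx : x ∈ trivialIsotropy C) :
    ∃ V : CompactOpens (Arrows.unitSpace C), x ∈ V ∧
      ∀ W ≤ V, unitChar S W * (f * unitChar S W) = f x • unitChar S W := by
  induction f using induction_on with
  | char U hU =>
    by_cases hxU : (x : Arrows C) ∈ U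
    · obtain ⟨V, hxV, hVU⟩ :=
        exists_mem_compactOpens_subset (hU.isOpen.preimage continuous_subtype_val) hxU
      refine ⟨V, hxV, fun W hW => ?_⟩
      rw [← mul_assoc, unitChar_mul_char hU (Set.image_subset_iff.2 (Set.Subset.trans hW hVU)),
        unitChar_mul_unitChar_of_le le_rfl, char_apply_of_mem hU hxU, one_smul]
    · obtain ⟨V, hxV, hV⟩ := exists_compactOpens_disjoint_corner hU.isCompact hx hxU
      refine ⟨V, hxV, fun W hW => ?_⟩
      rw [char_apply_of_notMem hU hxU, zero_smul]
      refine DFunLike.ext _ _ fun γ => ?_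
      by_cases hγ : Arrows.r γ ∈ W
      · rw [unitChar_mul_apply_of_mem _ hγ, unitChar, char_mul_char, char_apply_of_notMem,
          zero_apply]
        rintro ⟨α, hα, _, ⟨y, hy, rfl⟩, h, rfl⟩
        have hsα : Arrows.s α = y := (Arrows.s_eq_r.2 h).trans (Arrows.r_coe y)
        exact hV α hα (hW (hsα ▸ hy)) (hW hγ)
      · exact unitChar_mul_apply_of_notMem _ hγ
  | zero => exact (exists_mem_compactOpens_subset isOpen_univ (Set.mem_univ x)).imp fun V hV =>
      ⟨hV.1, fun W _ => by rw [zero_mul, mul_zero, zero_apply, zero_smul]⟩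
  | add f g hf hg =>
    obtain ⟨V, hxV, hV⟩ := hf
    obtain ⟨V', hxV', hV'⟩ := hg
    refine ⟨V ⊓ V', ⟨hxV, hxV'⟩, fun W hW => ?_⟩
    rw [add_mul, mul_add, hV W (hW.trans inf_le_left), hV' W (hW.trans inf_le_right), add_apply,
      add_smul]
  | smul a f hf =>
    obtain ⟨V, hxV, hV⟩ := hf
    refine ⟨V, hxV, fun W hW => ?_⟩
    rw [smul_mul_assoc, mul_smul_comm, hV W hW, smul_apply, mul_smul]

end Mul

end SteinbergAlgebra

/-! ### Congruences on the Steinberg algebra -/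

/-- The homomorphism `a ↦ a • e` from the scalars of an algebra defined by an idempotent `e`. -/
def smulIdempotentHom {S A : Type*} [CommSemiring S] [NonUnitalSemiring A] [Module S A]
    [IsScalarTower S A A] [SMulCommClass S A A] {e : A} (he : e * e = e) : S →ₙ+* A where
  toFun a := a • e
  map_mul' a b := by rw [smul_mul_smul_comm, he]
  map_zero' := zero_smul S e
  map_add' a b := add_smul a b e

namespace SteinbergAlgebra

variable {C : Type u} [Groupoid.{v} C] [TopologicalSpace (Arrows C)]

section BaseChange

variable {S : Type w} {S' : Type*} [CommSemiring S] [CommSemiring S'] (φ : S →+* S')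

theorem comp_mem_steinbergModule (f : SteinbergAlgebra S C) : φ ∘ f ∈ steinbergModule S' C := by
  induction f using induction_on with
  | char U hU =>
    refine Submodule.subset_span ⟨U, hU, (Set.indicator_comp_of_zero (map_zero φ)).symm.trans ?_⟩
    exact congrArg U.indicator (funext fun _ => map_one φ)
  | zero =>
    convert Submodule.zero_mem _
    exact funext fun _ => map_zero φ
  | add f g hf hg =>
    convert Submodule.add_mem _ hf hg
    exact funext fun _ => map_add φ _ _
  | smul a f hf =>
    convert Submodule.smul_mem _ (φ a) hf
    exact funext fun _ => map_mul φ _ _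

/-- Base change of the Steinberg algebra along a homomorphism of semirings. -/
def map [IsAmpleGroupoid C] : SteinbergAlgebra S C →ₙ+* SteinbergAlgebra S' C where
  toFun f := ⟨φ ∘ f, comp_mem_steinbergModule φ f⟩
  map_mul' f g := DFunLike.ext _ _ fun γ => by
    refine (φ.map_finsum (finite_support_conv f.2 g.1 γ)).trans ?_
    exact finsum_congr fun p => map_mul φ _ _
  map_zero' := DFunLike.ext _ _ fun _ => map_zero φ
  map_add' f g := DFunLike.ext _ _ fun _ => map_add φ _ _

theorem map_smul_char [IsAmpleGroupoid C] (a : S) {U : Set (Arrows C)}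
    (hU : IsCompactOpenBisection U) : map φ (a • char S hU) = φ a • char S' hU := by
  refine DFunLike.ext _ _ fun α => ?_
  change φ ((a • char S hU) α) = _
  by_cases hα : α ∈ U
  · rw [smul_apply, smul_apply, char_apply_of_mem hU hα, char_apply_of_mem hU hα, mul_one, mul_one]
  · rw [smul_apply, smul_apply, char_apply_of_notMem hU hα, char_apply_of_notMem hU hα, mul_zero,
      mul_zero, map_zero]

end BaseChange

variable [IsAmpleGroupoid C] {S : Type w} [CommSemiring S]

theorem exists_smul_unitChar_rel_of_not_le {d : RingCon (SteinbergAlgebra S C)}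
    (hd : ¬d ≤ steinbergCon S C) :
    ∃ V : CompactOpens (Arrows.unitSpace C), (V : Set (Arrows.unitSpace C)).Nonempty ∧
      ∃ a b : S, a ≠ b ∧ d (a • unitChar S V) (b • unitChar S V) := by
  obtain ⟨f, g, hfg, α, hα, hne⟩ : ∃ f g : SteinbergAlgebra S C, d f g ∧
      ∃ α, Arrows.s α ∈ trivialIsotropy C ∧ f α ≠ g α := by
    contrapose! hd
    exact fun f g hfg α hα _ => hd f g hfg α hα
  obtain ⟨B, hB, hαB⟩ := exists_isCompactOpenBisection_mem α.inv
  have hshift (k : SteinbergAlgebra S C) : (char S hB * k) (Arrows.s α) = k α := by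
    rw [← Arrows.inv_comp]
    exact char_mul_apply_comp hB k hαB rfl
  obtain ⟨V, hxV, hV⟩ := exists_forall_le_unitChar_corner (char S hB * f) hα
  obtain ⟨V', hxV', hV'⟩ := exists_forall_le_unitChar_corner (char S hB * g) hα
  refine ⟨V ⊓ V', ⟨_, hxV, hxV'⟩, f α, g α, hne, ?_⟩
  rw [← hshift f, ← hshift g, ← hV _ inf_le_left, ← hV' _ inf_le_right]
  exact d.mul (d.refl _) (d.mul (d.mul (d.refl _) hfg) (d.refl _))

/-- The ideal of compact open sets of units whose characteristic functions are congruent to zero;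
as a lattice ideal it encodes the open set of units near which the congruence collapses. -/
def nullIdeal (d : RingCon (SteinbergAlgebra S C)) :
    Order.Ideal (CompactOpens (Arrows.unitSpace C)) where
  carrier := {W | d (unitChar S W) 0}
  lower' W V hVW hW := by
    have := d.mul hW (d.refl (unitChar S V))
    rwa [unitChar_mul_unitChar_of_le hVW, zero_mul] at this
  nonempty' := ⟨⊥, show d (unitChar S ⊥) 0 from unitChar_bot (S := S) (C := C) ▸ d.refl 0⟩
  directed' V hV W hW := by
    refine ⟨V ⊔ W, ?_, le_sup_left, le_sup_right⟩
    have hWV : d (unitChar S (W \ V)) 0 := by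
      have := d.mul hW (d.refl (unitChar S (W \ V)))
      rwa [unitChar_mul_unitChar_of_le sdiff_le, zero_mul] at this
    rw [Set.mem_ofPred_eq, unitChar_sup, ← add_zero (0 : SteinbergAlgebra S C)]
    exact d.add hV hWV

theorem mem_opensEquiv_symm_nullIdeal {d : RingCon (SteinbergAlgebra S C)} {U : Set (Arrows C)}
    {hU : IsCompactOpenBisection U} (h : d (char S hU) 0) {y : Arrows.unitSpace C}
    (hy : (y : Arrows C) ∈ U) :
    y ∈ PrespectralSpace.opensEquiv.symm (nullIdeal d) := by
  obtain ⟨W, hyW, hWU⟩ :=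
    exists_mem_compactOpens_subset (hU.isOpen.preimage continuous_subtype_val) hy
  refine mem_opensEquiv_symm_iff.2 ⟨W, ?_, hyW⟩
  have := d.mul (d.refl (unitChar S W)) h
  rwa [unitChar_mul_char hU (Set.image_subset_iff.2 hWU), mul_zero] at this

theorem isInvariantUnits_nullIdeal (d : RingCon (SteinbergAlgebra S C)) :
    IsInvariantUnits
      (PrespectralSpace.opensEquiv.symm (nullIdeal d) : Set (Arrows.unitSpace C)) := by
  intro α hα
  obtain ⟨W, hW, hαW⟩ := mem_opensEquiv_symm_iff.1 hα
  obtain ⟨B, hB, hαB⟩ := exists_isCompactOpenBisection_mem α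
  obtain ⟨B', hB', hαB'⟩ := exists_isCompactOpenBisection_mem α.inv
  have hWc := isCompactOpenBisection_compactOpens W
  have hnull : d (char S (hB.setMul (hWc.setMul hB'))) 0 := by
    have := d.mul (d.refl (char S hB)) (d.mul hW (d.refl (char S hB')))
    rwa [unitChar, char_mul_char, char_mul_char, zero_mul, mul_zero] at this
  have hinv : α.inv ∈ Arrows.setMul ((↑) '' (W : Set (Arrows.unitSpace C))) B' :=
    ⟨_, ⟨_, hαW, rfl⟩, α.inv, hαB', rfl, Arrows.coe_comp α.inv _ rfl⟩
  exact mem_opensEquiv_symm_nullIdeal hnull ⟨α, hαB, α.inv, hinv, rfl, Arrows.comp_inv α⟩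

theorem nullIdeal_eq_top (hminimal : IsMinimalGroupoid C) {d : RingCon (SteinbergAlgebra S C)}
    {V : CompactOpens (Arrows.unitSpace C)} (hV : (V : Set (Arrows.unitSpace C)).Nonempty)
    (h : d (unitChar S V) 0) : nullIdeal d = ⊤ := by
  let D := PrespectralSpace.opensEquiv.symm (nullIdeal d)
  obtain ⟨y, hy⟩ := hV
  have hyD : y ∈ D := mem_opensEquiv_symm_iff.2 ⟨V, h, hy⟩
  have hD : (D : Set (Arrows.unitSpace C)) = Set.univ :=
    (hminimal D D.isOpen (isInvariantUnits_nullIdeal d)).resolve_left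
      (Set.nonempty_of_mem hyD).ne_empty
  exact (PrespectralSpace.opensEquiv.symm_apply_eq.1 (Opens.ext hD)).trans (OrderIso.map_top _)

theorem eq_top_of_unitChar_rel_zero (hminimal : IsMinimalGroupoid C)
    {d : RingCon (SteinbergAlgebra S C)} {V : CompactOpens (Arrows.unitSpace C)}
    (hV : (V : Set (Arrows.unitSpace C)).Nonempty) (h : d (unitChar S V) 0) : d = ⊤ := by
  have hzero (f : SteinbergAlgebra S C) : d f 0 := by
    obtain ⟨W, hW⟩ := exists_compactOpens_r_mem f
    have hWd : W ∈ nullIdeal d := nullIdeal_eq_top hminimal hV h ▸ trivial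
    have := d.mul hWd (d.refl f)
    rwa [unitChar_mul_eq_self hW, zero_mul] at this
  exact top_le_iff.1 fun f g _ => d.trans (hzero f) (d.symm (hzero g))

end SteinbergAlgebra

open SteinbergAlgebra

section Quotient

variable {S : Type w} [CommSemiring S] {C : Type u} [Groupoid.{v} C] [TopologicalSpace (Arrows C)]
  [IsAmpleGroupoid C]

theorem IsCongruenceSimple.quotient_steinbergCon (hS : IsCongruenceSimple S)
    (hminimal : IsMinimalGroupoid C) : IsCongruenceSimple (steinbergCon S C).Quotient := by
  refine isCongruenceSimple_quotient_iff.2 fun d hd => ?_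
  by_cases hd' : d ≤ steinbergCon S C
  · exact .inl (hd'.antisymm hd)
  · obtain ⟨V, hV, a, b, hab, hVab⟩ := exists_smul_unitChar_rel_of_not_le hd'
    let φ := smulIdempotentHom (S := S) (unitChar_mul_unitChar_of_le (S := S) (le_refl V))
    have hφ : d.comap φ = ⊤ := (hS (d.comap φ)).resolve_left fun h => hab (h.le hVab)
    have hV0 : d (unitChar S V) 0 := by
      have hφ10 : d (φ 1) (φ 0) := hφ.ge trivial
      rwa [map_zero, show φ 1 = unitChar S V from one_smul S _] at hφ10
    exact .inr (eq_top_of_unitChar_rel_zero hminimal hV hV0)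

theorem IsCongruenceSimple.of_quotient_steinbergCon (hT : (trivialIsotropy C).Nonempty)
    (h : IsCongruenceSimple (steinbergCon S C).Quotient) : IsCongruenceSimple S := by
  intro c
  obtain ⟨x, hx⟩ := hT
  obtain ⟨V, hxV, -⟩ := exists_mem_compactOpens_subset isOpen_univ (Set.mem_univ x)
  let d := (steinbergCon c.Quotient C).comap (SteinbergAlgebra.map c.mk')
  have hle : steinbergCon S C ≤ d := fun f g hfg α hs hr => congrArg c.mk' (hfg α hs hr)
  have hdV {a b : S} : d (a • unitChar S V) (b • unitChar S V) ↔
      steinbergCon c.Quotient C (c.mk' a • unitChar _ V) (c.mk' b • unitChar _ V) := by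
    rw [RingCon.comap_rel, unitChar, map_smul_char, map_smul_char, ← unitChar]
  refine (isCongruenceSimple_quotient_iff.1 h d hle).imp (fun hd => ?_) fun hd => ?_
  · refine le_bot_iff.1 fun a b hab => ?_
    have hdab : d (a • unitChar S V) (b • unitChar S V) :=
      hdV.2 ((show c.mk' a = c.mk' b from c.eq.2 hab) ▸ RingCon.refl _ _)
    exact eq_of_steinbergCon_smul_unitChar hx hxV (hd.le hdab)
  · refine top_le_iff.1 fun a b _ => c.eq.1 ?_
    exact eq_of_steinbergCon_smul_unitChar hx hxV (hdV.1 (hd.ge trivial))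

theorem isCongruenceSimple_quotient_steinbergCon_iff (hT : (trivialIsotropy C).Nonempty)
    (hminimal : IsMinimalGroupoid C) :
    IsCongruenceSimple (steinbergCon S C).Quotient ↔ IsCongruenceSimple S :=
  ⟨.of_quotient_steinbergCon hT, fun hS => hS.quotient_steinbergCon hminimal⟩

end Quotient

theorem proposition3p6_general {C : Type u} [Groupoid.{v} C] [TopologicalSpace (Arrows C)]
    [IsAmpleGroupoid C] (hT : (trivialIsotropy C).Nonempty) (hminimal : IsMinimalGroupoid C)
    (S : Type w) [CommSemiring S] [Nontrivial S] :
    IsCongruenceSimple (steinbergCon S C).Quotient ↔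
      (∃ (F : Type w) (_ : Field F), Nonempty (S ≃+* F)) ∨ Nonempty (S ≃+* BoolSemifield) :=
  (isCongruenceSimple_quotient_steinbergCon_iff hT hminimal).trans
    isCongruenceSimple_iff_field_or_boolSemifield

theorem proposition3p6 {C : Type u} [Groupoid.{v} C] [TopologicalSpace (Arrows C)]
    [IsAmpleGroupoid C] [Nonempty C] (hprincipal : IsTopologicallyPrincipal C)
    (hminimal : IsMinimalGroupoid C) (S : Type w) [Semifield S] :
    IsCongruenceSimple (steinbergCon S C).Quotient ↔
      (∃ (F : Type w) (_ : Field F), Nonempty (S ≃+* F)) ∨ Nonempty (S ≃+* BoolSemifield) := by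
  exact proposition3p6_general hprincipal.nonempty hminimal S
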